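/- For an integer $N\ge 0$, real numbers $a,b>0$ and a function $f$ on $[0,1]^N$ put \[ \langle f\rangle_{a,b}=\frac1{N!}\int_{[0,1]^N}f(x_1,\dots,x_N)\prod_{1\le i<j\le N}(x_i-x_j)^2\prod_{i=1}^N x_i^{a-1}(1-x_i)^{b-1}\,dx_1\cdots dx_N . \] Let $\lambda=(\lambda_1\ge\lambda_2\ge\cdots)$ be a partition with $\ell(\lambda)$ nonzero parts and $|\lambda|=\sum_i\lambda_i$, and for $N\ge\ell(\lambda)$ let \[ s_\lambda(x_1,\dots,x_N)=\frac{\det\bigl(x_i^{\lambda_j+N-j}\bigr)_{1\le i,j\le N}}{\prod_{1\le i<j\le N}(x_i-x_j)} \] be the Schur function. (1) For all $N\ge\ell(\lambda)$ and all real $a,b>0$, the integrals $\langle s_\lambda\rangle_{a,b}$ and $\langle 1\rangle_{a,b}$ converge absolutely, $\langle 1\rangle_{a,b}>0$, and \[ \frac{\langle s_\lambda(x_1,\dots,x_N)\rangle_{a,b}}{\langle 1\rangle_{a,b}} =\prod_{i=1}^{\ell(\lambda)}\left[\prod_{j=i+1}^{\ell(\lambda)}\frac{\lambda_i-\lambda_j+j-i}{j-i}\;\prod_{j=0}^{\lambda_i-1}\frac{(j+N-i+1)(a+N-i+j)}{(\ell(\lambda)+j-i+1)(a+b+2N-i+j-1)}\right].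 \] (2) Let $a=a_1N+a_0$ and $b=b_1N+b_0$ with real constants $a_0,a_1,b_0,b_1$ such that $a>0$ and $b>0$ for all sufficiently large $N$. Then \[ \frac{\langle s_\lambda(x_1,\dots,x_N)\rangle_{a,b}}{N^{|\lambda|}\,\langle 1\rangle_{a,b}}\;\xrightarrow[N\to\infty]{}\; \left(\frac{1+a_1}{2+a_1+b_1}\right)^{|\lambda|}\prod_{i=1}^{\ell(\lambda)}\left[\prod_{j=i+1}^{\ell(\lambda)}\frac{\lambda_i-\lambda_j+j-i}{j-i}\;\prod_{j=0}^{\lambda_i-1}\frac1{\ell(\lambda)+j-i+1}\right]. \] -/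

import Mathlib

namespace Selberg

/-- The integrand of `⟨f⟩_{a,b}` in `N` variables, without the factor `1 / N!`:
`f(x) ∏_{i<j} (x_i - x_j)^2 ∏_i x_i^(a-1) (1-x_i)^(b-1)`. -/
noncomputable def integrand (N : ℕ) (a b : ℝ) (f : (Fin N → ℝ) → ℝ) (x : Fin N → ℝ) : ℝ :=
  f x * (∏ i : Fin N, ∏ j ∈ Finset.Ioi i, (x i - x j) ^ 2) *
    ∏ i : Fin N, (x i ^ (a - 1) * (1 - x i) ^ (b - 1))

/-- `⟨f⟩_{a,b} = (1 / N!) ∫_{[0,1]^N} f(x) ∏_{i<j} (x_i - x_j)^2 ∏_i x_i^(a-1) (1-x_i)^(b-1) dx`. -/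
noncomputable def average (N : ℕ) (a b : ℝ) (f : (Fin N → ℝ) → ℝ) : ℝ :=
  1 / (N.factorial : ℝ) * ∫ x in Set.Icc (0 : Fin N → ℝ) 1, integrand N a b f x

/-- A partition `λ` is represented by its Young diagram, the part `λ_{i+1}` being
`lam.rowLen i` (zero past the last row); `length lam` is the number `ℓ(λ)` of nonzero parts. -/
def length (lam : YoungDiagram) : ℕ := lam.colLen 0

/-- `|λ| = ∑_i λ_i`. -/
def size (lam : YoungDiagram) : ℕ := ∑ i ∈ Finset.range (length lam), lam.rowLen i

/-- The Schur function `s_λ(x_1, …, x_N)` for `ℓ(λ) ≤ N`, as the quotient of alternants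
`det (x_i^(λ_j + N - j))_{1 ≤ i, j ≤ N} / ∏_{i<j} (x_i - x_j)`. The indices here start at `0`.
At points with two equal coordinates the quotient is `0` by convention; these points form a null
set, and the squared Vandermonde factor of `integrand` vanishes there. -/
noncomputable def schur (N : ℕ) (lam : YoungDiagram) (x : Fin N → ℝ) : ℝ :=
  (Matrix.of fun i j : Fin N => x i ^ (lam.rowLen j + (N - 1 - (j : ℕ)))).det /
    ∏ i : Fin N, ∏ j ∈ Finset.Ioi i, (x i - x j)

end Selberg

/-!
By the Vandermonde formula one of the two factors `∏_{i<j} (x_i - x_j)` equals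
`det ((1 - x_i)^k)`, so the integrand of `⟨s_λ⟩` is `det (x_i^(l_j)) det ((1 - x_i)^k)` times the
weight, where `l_j = λ_j + N - j`. Andréief's identity turns its integral into
`N! det B(a + l_j, b + k)`. Up to Gamma factors depending on `j` only or on `k` only, the entry
`B(a + l_j, b + k)` is a monic polynomial in `l_j` of degree `N - 1 - k`, so the determinant is
again a Vandermonde determinant, now in the `l_j`. The empty partition gives `⟨1⟩`, and in the
quotient the Gamma factors telescope.
-/

namespace Selberg

open MeasureTheory Finset Polynomial ProbabilityTheory

section Determinants

theorem det_mul_det_eq_sum_sign_mul_det {ι R : Type*} [Fintype ι] [DecidableEq ι] [CommRing R]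
    (A B : Matrix ι ι R) :
    A.det * B.det = ∑ σ : Equiv.Perm ι,
      ((σ.sign : ℤ) : R) * (Matrix.of fun i j => A i (σ i) * B i j).det := by
  simp only [Matrix.det_mul_column]
  rw [← Matrix.det_transpose, Matrix.det_apply', sum_mul]
  simp only [Matrix.transpose_apply, mul_assoc]

theorem det_eval_eq_prod_sub_of_natDegree_eq_rev {R : Type*} [CommRing R] {n : ℕ} (v : Fin n → R)
    (p : Fin n → R[X]) (hdeg : ∀ k, (p k).natDegree = k.rev) (hmonic : ∀ k, (p k).Monic) :
    (Matrix.of fun i k => (p k).eval (v i)).det = ∏ i, ∏ j ∈ Ioi i, (v i - v j) := by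
  calc (Matrix.of fun i k => (p k).eval (v i)).det
      = (Matrix.of fun i k => (p (Fin.rev k)).eval (v (Fin.rev i))).det :=
        (Matrix.det_submatrix_equiv_self Fin.revPerm _).symm
    _ = (Matrix.vandermonde (v ∘ Fin.rev)).det :=
        (Matrix.det_eval_matrixOfPolynomials_eq_det_vandermonde _ _
          (fun k => by rw [hdeg, Fin.rev_rev]) fun k => hmonic _).symm
    _ = ((Matrix.projVandermonde 1 v).submatrix Fin.revPerm Fin.revPerm).det := by
        congr 1
        ext i k
        simp [Matrix.vandermonde_apply, Matrix.projVandermonde_apply]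
    _ = ∏ i, ∏ j ∈ Ioi i, (v i - v j) := by
        simp [Matrix.det_submatrix_equiv_self, Matrix.det_projVandermonde]

theorem det_pow_rev_eq_prod_sub {R : Type*} [CommRing R] {n : ℕ} (v : Fin n → R) :
    (Matrix.of fun i k => v i ^ (Fin.rev k : ℕ)).det = ∏ i, ∏ j ∈ Ioi i, (v i - v j) := by
  nontriviality R
  simpa using det_eval_eq_prod_sub_of_natDegree_eq_rev v (fun k => X ^ (Fin.rev k : ℕ))
    (fun k => natDegree_X_pow _) fun k => monic_X_pow _

end Determinants

section Andreief

variable {ι 𝕜 : Type*} [Fintype ι] [DecidableEq ι] [RCLike 𝕜]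

section Rows

variable {α : ι → Type*} [∀ i, MeasurableSpace (α i)] {μ : ∀ i, Measure (α i)}
  [∀ i, SigmaFinite (μ i)] {h : ∀ i, ι → α i → 𝕜}

theorem integrable_det_of_rows (hh : ∀ i j, Integrable (h i j) (μ i)) :
    Integrable (fun x : ∀ i, α i => (Matrix.of fun i j => h i j (x i)).det) (Measure.pi μ) := by
  simp_rw [← Matrix.det_transpose (Matrix.of _), Matrix.det_apply']
  exact integrable_finsetSum _ fun σ _ =>
    (Integrable.fintype_prod_dep fun i => hh i (σ i)).const_mul _

theorem integral_det_of_rows (hh : ∀ i j, Integrable (h i j) (μ i)) :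
    ∫ x : ∀ i, α i, (Matrix.of fun i j => h i j (x i)).det ∂Measure.pi μ =
      (Matrix.of fun i j => ∫ t, h i j t ∂μ i).det := by
  simp_rw [← Matrix.det_transpose (Matrix.of _), Matrix.det_apply']
  rw [integral_finsetSum _ fun σ _ =>
    (Integrable.fintype_prod_dep fun i => hh i (σ i)).const_mul _]
  refine sum_congr rfl fun σ _ => ?_
  rw [integral_const_mul]
  exact congrArg _ (integral_fintype_prod_eq_prod fun i => h i (σ i))

end Rows

variable {α : Type*} [MeasurableSpace α] {μ : Measure α} [SigmaFinite μ] {f g : ι → α → 𝕜}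

theorem integrable_det_mul_det (hfg : ∀ j k, Integrable (fun t => f j t * g k t) μ) :
    Integrable (fun x : ι → α =>
      (Matrix.of fun i j => f j (x i)).det * (Matrix.of fun i j => g j (x i)).det)
      (Measure.pi fun _ => μ) := by
  simp_rw [det_mul_det_eq_sum_sign_mul_det]
  exact integrable_finsetSum _ fun σ _ =>
    (integrable_det_of_rows fun i k => hfg (σ i) k).const_mul _

theorem integral_det_mul_det (hfg : ∀ j k, Integrable (fun t => f j t * g k t) μ) :
    ∫ x : ι → α, (Matrix.of fun i j => f j (x i)).det * (Matrix.of fun i j => g j (x i)).det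
      ∂(Measure.pi fun _ => μ) =
    (Fintype.card ι).factorial * (Matrix.of fun j k => ∫ t, f j t * g k t ∂μ).det := by
  set M : Matrix ι ι 𝕜 := Matrix.of fun j k => ∫ t, f j t * g k t ∂μ
  have sign_sq (σ : Equiv.Perm ι) : ((σ.sign : ℤ) : 𝕜) * ((σ.sign : ℤ) : 𝕜) = 1 := by
    rw [← Int.cast_mul, ← Units.val_mul, Int.units_mul_self, Units.val_one, Int.cast_one]
  have integral_summand (σ : Equiv.Perm ι) :
      ∫ x : ι → α, ((σ.sign : ℤ) : 𝕜) * (Matrix.of fun i k => f (σ i) (x i) * g k (x i)).det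
        ∂(Measure.pi fun _ => μ) = M.det := by
    rw [integral_const_mul, integral_det_of_rows fun i k => hfg (σ i) k]
    change _ * (M.submatrix σ id).det = M.det
    rw [Matrix.det_permute, ← mul_assoc, sign_sq, one_mul]
  simp_rw [det_mul_det_eq_sum_sign_mul_det]
  rw [integral_finsetSum _ fun σ _ =>
    (integrable_det_of_rows fun i k => hfg (σ i) k).const_mul _]
  simp only [Matrix.of_apply, integral_summand, sum_const, card_univ, Fintype.card_perm,
    nsmul_eq_mul]

end Andreief

section Beta

/-- The weight `x^(a-1) (1-x)^(b-1)` of the beta integral. -/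
noncomputable def betaWeight (a b x : ℝ) : ℝ := x ^ (a - 1) * (1 - x) ^ (b - 1)

theorem ofReal_betaWeight (a b : ℝ) {x : ℝ} (hx : x ∈ Set.Icc (0 : ℝ) 1) :
    (betaWeight a b x : ℂ) = (x : ℂ) ^ ((a : ℂ) - 1) * (1 - (x : ℂ)) ^ ((b : ℂ) - 1) := by
  rw [betaWeight, Complex.ofReal_mul, Complex.ofReal_cpow hx.1,
    Complex.ofReal_cpow (sub_nonneg.2 hx.2)]
  push_cast
  rfl

variable {a b : ℝ}

theorem integrableOn_betaWeight (ha : 0 < a) (hb : 0 < b) :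
    IntegrableOn (betaWeight a b) (Set.Icc 0 1) := by
  have hconv := Complex.betaIntegral_convergent (u := a) (v := b) (by simpa) (by simpa)
  rw [intervalIntegrable_iff_integrableOn_Icc_of_le zero_le_one] at hconv
  refine IntegrableOn.congr_fun hconv.re (fun x hx => ?_) measurableSet_Icc
  rw [← ofReal_betaWeight a b hx, RCLike.re_to_complex, Complex.ofReal_re]

theorem setIntegral_betaWeight (ha : 0 < a) (hb : 0 < b) :
    ∫ x in Set.Icc (0 : ℝ) 1, betaWeight a b x = beta a b := by
  rw [beta_eq_betaIntegralReal a b ha hb, Complex.betaIntegral,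
    intervalIntegral.integral_of_le zero_le_one, ← integral_Icc_eq_integral_Ioc,
    ← setIntegral_congr_fun measurableSet_Icc fun x hx => ofReal_betaWeight a b hx,
    integral_complex_ofReal, Complex.ofReal_re]

theorem pow_mul_betaWeight_mul_pow_ae_eq (a b : ℝ) (m n : ℕ) :
    (fun x => x ^ m * betaWeight a b x * (1 - x) ^ n) =ᵐ[volume.restrict (Set.Icc 0 1)]
      betaWeight (a + m) (b + n) := by
  rw [← Measure.restrict_congr_set Ioo_ae_eq_Icc]
  refine ae_restrict_of_forall_mem measurableSet_Ioo fun x hx => ?_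
  simp only [betaWeight]
  rw [add_sub_right_comm, add_sub_right_comm, Real.rpow_add_natCast hx.1.ne',
    Real.rpow_add_natCast (sub_pos.2 hx.2).ne']
  ring

theorem integrableOn_pow_mul_betaWeight_mul_pow (ha : 0 < a) (hb : 0 < b) (m n : ℕ) :
    IntegrableOn (fun x => x ^ m * betaWeight a b x * (1 - x) ^ n) (Set.Icc 0 1) :=
  (integrableOn_betaWeight (by positivity) (by positivity)).congr
    (pow_mul_betaWeight_mul_pow_ae_eq a b m n).symm

theorem setIntegral_pow_mul_betaWeight_mul_pow (ha : 0 < a) (hb : 0 < b) (m n : ℕ) :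
    ∫ x in Set.Icc (0 : ℝ) 1, x ^ m * betaWeight a b x * (1 - x) ^ n = beta (a + m) (b + n) := by
  rw [integral_congr_ae (pow_mul_betaWeight_mul_pow_ae_eq a b m n),
    setIntegral_betaWeight (by positivity) (by positivity)]

end Beta

section Gamma

theorem ascPochhammer_eval_eq_prod_range {R : Type*} [CommSemiring R] (x : R) (n : ℕ) :
    (ascPochhammer R n).eval x = ∏ t ∈ range n, (x + t) := by
  induction n with
  | zero => simp
  | succ n ih => rw [ascPochhammer_succ_eval, prod_range_succ, ih]

theorem Gamma_add_natCast {x : ℝ} (hx : 0 < x) (n : ℕ) :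
    Real.Gamma (x + n) = (ascPochhammer ℝ n).eval x * Real.Gamma x := by
  induction n with
  | zero => simp
  | succ n ih =>
    rw [Nat.cast_succ, ← add_assoc, Real.Gamma_add_one (by positivity), ih,
      ascPochhammer_succ_eval]
    ring

theorem Gamma_div_Gamma_add_natCast {x y : ℝ} (hx : 0 < x) (hy : 0 < y) (n : ℕ) :
    Real.Gamma (x + n) / Real.Gamma (y + n) / (Real.Gamma x / Real.Gamma y) =
      ∏ t ∈ range n, (x + t) / (y + t) := by
  rw [prod_div_distrib, ← ascPochhammer_eval_eq_prod_range, ← ascPochhammer_eval_eq_prod_range,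
    Gamma_add_natCast hx, Gamma_add_natCast hy, mul_div_mul_comm, mul_div_cancel_right₀]
  exact (div_pos (Real.Gamma_pos_of_pos hx) (Real.Gamma_pos_of_pos hy)).ne'

theorem cast_rev {R : Type*} [Ring R] {N : ℕ} (j : Fin N) :
    ((Fin.rev j : ℕ) : R) = N - 1 - (j : ℕ) := by
  rw [Fin.val_rev, Nat.cast_sub j.2, Nat.cast_succ, sub_add_eq_sub_sub_swap]

theorem Gamma_quotient_div_Gamma_quotient_rev {a b : ℝ} (ha : 0 < a) (hb : 0 < b) (n : ℕ) {N : ℕ}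
    (i : Fin N) :
    Real.Gamma (a + (n + Fin.rev i : ℕ)) / Real.Gamma (a + (n + Fin.rev i : ℕ) + b + (N - 1)) /
        (Real.Gamma (a + (Fin.rev i : ℕ)) / Real.Gamma (a + (Fin.rev i : ℕ) + b + (N - 1))) =
      ∏ t ∈ range n, (a + N - (i + 1) + t) / (a + b + 2 * N - (i + 1) + t - 1) := by
  have hN : (0 : ℝ) ≤ N - 1 := sub_nonneg.2 (Nat.one_le_cast.2 i.pos)
  have hquot := Gamma_div_Gamma_add_natCast (x := a + (Fin.rev i : ℕ))
    (y := a + (Fin.rev i : ℕ) + b + (N - 1)) (by positivity) (by positivity) n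
  convert hquot using 2
  · push_cast
    congr 2 <;> ring
  · rw [cast_rev]
    congr 1 <;> ring

variable {N : ℕ} {b : ℝ}

/-- The factor of `B(x, b + k)` that is polynomial in `x`, after Gamma factors depending on `x`
only or on `k` only have been split off. -/
noncomputable def betaPoly (b : ℝ) (k : Fin N) : ℝ[X] :=
  (ascPochhammer ℝ (Fin.rev k)).comp (X + C (b + k))

theorem natDegree_betaPoly (b : ℝ) (k : Fin N) : (betaPoly b k).natDegree = Fin.rev k := by
  rw [betaPoly, natDegree_comp, ascPochhammer_natDegree, natDegree_X_add_C, mul_one]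

theorem monic_betaPoly (b : ℝ) (k : Fin N) : (betaPoly b k).Monic :=
  (monic_ascPochhammer ℝ _).comp_X_add_C _

theorem beta_add_eq_mul_eval_betaPoly {x : ℝ} (hx : 0 < x) (hb : 0 < b) (k : Fin N) :
    beta x (b + k) = Real.Gamma x / Real.Gamma (x + b + (N - 1)) *
      (Real.Gamma (b + k) * (betaPoly b k).eval x) := by
  have hpos : 0 < x + (b + k) := by positivity
  have hGamma : Real.Gamma (x + b + (N - 1)) =
      (betaPoly b k).eval x * Real.Gamma (x + (b + k)) := by
    rw [betaPoly, eval_comp, eval_add, eval_X, eval_C, ← Gamma_add_natCast hpos, cast_rev]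
    congr 1
    ring
  have hpoly : (betaPoly b k).eval x ≠ 0 := by
    rw [betaPoly, eval_comp, eval_add, eval_X, eval_C]
    exact (ascPochhammer_pos _ _ hpos).ne'
  rw [beta, hGamma]
  field_simp

theorem det_beta_add {x : Fin N → ℝ} (hx : ∀ j, 0 < x j) (hb : 0 < b) :
    (Matrix.of fun j k : Fin N => beta (x j) (b + k)).det =
      (∏ j, Real.Gamma (x j) / Real.Gamma (x j + b + (N - 1))) *
        ((∏ k : Fin N, Real.Gamma (b + k)) * ∏ i, ∏ j ∈ Ioi i, (x i - x j)) := by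
  simp only [beta_add_eq_mul_eval_betaPoly (hx _) hb]
  rw [← det_eval_eq_prod_sub_of_natDegree_eq_rev x _ (natDegree_betaPoly b) (monic_betaPoly b),
    ← Matrix.det_mul_row, ← Matrix.det_mul_column]
  rfl

end Gamma

section WeylDimension

theorem prod_Ico_div_eq_prod_range_div {K : Type*} [Field K] {u : ℕ → K} {l N : ℕ}
    (hu : ∀ n, l ≤ n → u n ≠ 0) (hN : l ≤ N) (m : ℕ) :
    ∏ j ∈ Ico l N, u (j + m) / u j = ∏ t ∈ range m, u (N + t) / u (l + t) := by
  have hIco : ∏ j ∈ Ico l N, u j ≠ 0 := prod_ne_zero_iff.2 fun j hj => hu j (mem_Ico.1 hj).1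
  have hrange : ∏ t ∈ range m, u (l + t) ≠ 0 :=
    prod_ne_zero_iff.2 fun t _ => hu _ (Nat.le_add_right l t)
  have range_eq_Ico (n : ℕ) : ∏ t ∈ range m, u (n + t) = ∏ j ∈ Ico n (n + m), u j := by
    rw [prod_Ico_eq_prod_range, Nat.add_sub_cancel_left]
  rw [prod_div_distrib, prod_div_distrib, div_eq_div_iff hIco hrange, prod_Ico_add', range_eq_Ico,
    range_eq_Ico, mul_comm, mul_comm (∏ j ∈ Ico N _, _),
    prod_Ico_consecutive _ (Nat.le_add_right l m) (by lia),
    prod_Ico_consecutive _ hN (Nat.le_add_right N m)]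

/-- The Weyl dimension formula: for a partition `m` with at most `N` parts this is
`s_m(1, …, 1)` in `N` variables. Rows are indexed from `0`. -/
noncomputable def weylDimension (m : ℕ → ℕ) (N : ℕ) : ℝ :=
  ∏ i ∈ range N, ∏ j ∈ Ioo i N, ((m i : ℝ) - m j + j - i) / ((j : ℝ) - i)

theorem prod_sub_div_prod_sub_rev (m : ℕ → ℕ) (N : ℕ) :
    (∏ i : Fin N, ∏ j ∈ Ioi i, (((m i + Fin.rev i : ℕ) : ℝ) - (m j + Fin.rev j : ℕ))) /
        ∏ i : Fin N, ∏ j ∈ Ioi i, (((Fin.rev i : ℕ) : ℝ) - (Fin.rev j : ℕ)) =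
      weylDimension m N := by
  rw [weylDimension, ← prod_div_distrib, ← Fin.prod_univ_eq_prod_range
    (fun i => ∏ j ∈ Ioo i N, ((m i : ℝ) - m j + j - i) / ((j : ℝ) - i))]
  refine prod_congr rfl fun i _ => ?_
  rw [← prod_div_distrib, ← Fin.map_valEmbedding_Ioi, prod_map]
  refine prod_congr rfl fun j _ => ?_
  rw [Fin.valEmbedding_apply]
  push_cast [cast_rev]
  congr 1 <;> ring

theorem weylDimension_eq_mul_of_eq_zero {m : ℕ → ℕ} {l N : ℕ} (hN : l ≤ N)
    (hm : ∀ i, l ≤ i → m i = 0) :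
    weylDimension m N = weylDimension m l *
      ∏ i ∈ range l, ∏ t ∈ range (m i), ((t : ℝ) + N - i) / ((t : ℝ) + l - i) := by
  have hrows_ge : ∏ i ∈ Ico l N, ∏ j ∈ Ioo i N, ((m i : ℝ) - m j + j - i) / ((j : ℝ) - i) = 1 := by
    refine prod_eq_one fun i hi => prod_eq_one fun j hj => ?_
    have hli : l ≤ i := (mem_Ico.1 hi).1
    have hij : i < j := (mem_Ioo.1 hj).1
    rw [hm i hli, hm j (hli.trans hij.le), sub_self, zero_add,
      div_self (sub_pos.2 (Nat.cast_lt.2 hij)).ne']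
  rw [weylDimension, weylDimension, ← prod_range_mul_prod_Ico _ hN, hrows_ge, mul_one,
    ← prod_mul_distrib]
  refine prod_congr rfl fun i hi => ?_
  have hil : i < l := mem_range.1 hi
  have hcols_ge : ∏ j ∈ Ico l N, ((m i : ℝ) - m j + j - i) / ((j : ℝ) - i) =
      ∏ t ∈ range (m i), ((t : ℝ) + N - i) / ((t : ℝ) + l - i) := by
    have hne (n : ℕ) (hn : l ≤ n) : (n : ℝ) - i ≠ 0 :=
      (sub_pos.2 (Nat.cast_lt.2 (hil.trans_le hn))).ne'
    convert prod_Ico_div_eq_prod_range_div hne hN (m i) using 2 with j hj t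
    · rw [hm j (mem_Ico.1 hj).1]
      push_cast
      ring
    · push_cast
      congr 1 <;> ring
  rw [← hcols_ge, ← Ico_add_one_left_eq_Ioo, ← Ico_add_one_left_eq_Ioo,
    prod_Ico_consecutive _ (Nat.add_one_le_iff.2 hil) hN]

end WeylDimension

section Averages

theorem restrict_Icc_zero_one_eq_pi (ι : Type*) [Fintype ι] :
    (volume : Measure (ι → ℝ)).restrict (Set.Icc 0 1) =
      Measure.pi fun _ => volume.restrict (Set.Icc (0 : ℝ) 1) := by
  rw [← Measure.restrict_pi_pi, volume_pi, ← Set.pi_univ_Icc]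
  rfl

variable {N : ℕ} {a b : ℝ} {l : Fin N → ℕ} {f : (Fin N → ℝ) → ℝ}

/-- The alternant `det (x_i^(l_j))`. -/
noncomputable def alternant (l : Fin N → ℕ) (x : Fin N → ℝ) : ℝ :=
  (Matrix.of fun i j => x i ^ l j).det

/-- `f` is the alternant of `l` divided by `∏_{i<j} (x_i - x_j)`, as far as the averages can see:
the values of `f` on the diagonals `x_i = x_j` are arbitrary. -/
def IsAlternantQuotient (l : Fin N → ℕ) (f : (Fin N → ℝ) → ℝ) : Prop :=
  ∀ x, (∏ i, ∏ j ∈ Ioi i, (x i - x j)) ≠ 0 → f x * ∏ i, ∏ j ∈ Ioi i, (x i - x j) = alternant l x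

theorem isAlternantQuotient_schur (N : ℕ) (lam : YoungDiagram) :
    IsAlternantQuotient (fun j : Fin N => lam.rowLen j + Fin.rev j) (schur N lam) := by
  intro x hx
  rw [schur, div_mul_cancel₀ _ hx, alternant]
  simp only [Fin.val_rev, Nat.sub_sub, add_comm 1]

theorem isAlternantQuotient_one (N : ℕ) :
    IsAlternantQuotient (fun j : Fin N => (Fin.rev j : ℕ)) fun _ => 1 := fun x _ => by
  rw [one_mul, alternant, det_pow_rev_eq_prod_sub]

namespace IsAlternantQuotient

theorem integrand_eq (hf : IsAlternantQuotient l f) (a b : ℝ) (x : Fin N → ℝ) :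
    integrand N a b f x =
      (Matrix.of fun i j => x i ^ l j * betaWeight a b (x i)).det *
        (Matrix.of fun i k : Fin N => (1 - x i) ^ (k : ℕ)).det := by
  have hvand : (Matrix.of fun i k : Fin N => (1 - x i) ^ (k : ℕ)).det =
      ∏ i, ∏ j ∈ Ioi i, (x i - x j) :=
    (Matrix.det_vandermonde fun i => 1 - x i).trans (by simp only [sub_sub_sub_cancel_left])
  have hweight : (Matrix.of fun i j => x i ^ l j * betaWeight a b (x i)).det =
      (∏ i, betaWeight a b (x i)) * alternant l x := by
    simpa only [mul_comm, Matrix.of_apply, alternant] using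
      Matrix.det_mul_column (fun i => betaWeight a b (x i)) (Matrix.of fun i j => x i ^ l j)
  rw [hvand, hweight, integrand]
  simp only [prod_pow, betaWeight]
  rcases eq_or_ne (∏ i, ∏ j ∈ Ioi i, (x i - x j)) 0 with hzero | hne
  · simp [hzero]
  · rw [← hf x hne]
    ring

theorem integrableOn_integrand (hf : IsAlternantQuotient l f) (ha : 0 < a) (hb : 0 < b) :
    IntegrableOn (integrand N a b f) (Set.Icc 0 1) := by
  rw [funext (hf.integrand_eq a b), IntegrableOn, restrict_Icc_zero_one_eq_pi]
  exact integrable_det_mul_det fun j k => integrableOn_pow_mul_betaWeight_mul_pow ha hb (l j) k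

theorem average_eq (hf : IsAlternantQuotient l f) (ha : 0 < a) (hb : 0 < b) :
    average N a b f =
      (∏ j, Real.Gamma (a + l j) / Real.Gamma (a + l j + b + (N - 1))) *
        ((∏ k : Fin N, Real.Gamma (b + k)) * ∏ i, ∏ j ∈ Ioi i, ((l i : ℝ) - l j)) := by
  have hint : ∫ x in Set.Icc (0 : Fin N → ℝ) 1, integrand N a b f x =
      N.factorial * (Matrix.of fun j k : Fin N => beta (a + l j) (b + k)).det := by
    rw [funext (hf.integrand_eq a b), restrict_Icc_zero_one_eq_pi]
    simpa only [setIntegral_pow_mul_betaWeight_mul_pow ha hb, Fintype.card_fin] using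
      integral_det_mul_det fun j k => integrableOn_pow_mul_betaWeight_mul_pow ha hb (l j) k
  rw [average, hint, ← mul_assoc, one_div_mul_cancel (by positivity), one_mul,
    det_beta_add (fun j => by positivity) hb]
  simp only [add_sub_add_left_eq_sub]

end IsAlternantQuotient

theorem average_one_pos (ha : 0 < a) (hb : 0 < b) : 0 < average N a b fun _ => 1 := by
  rw [(isAlternantQuotient_one N).average_eq ha hb]
  have hN (j : Fin N) : (0 : ℝ) ≤ N - 1 := sub_nonneg.2 (Nat.one_le_cast.2 j.pos)
  refine mul_pos (prod_pos fun j _ => div_pos ?_ ?_) (mul_pos (prod_pos fun k _ => ?_)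
    (prod_pos fun i _ => prod_pos fun j hij => ?_))
  · exact Real.Gamma_pos_of_pos (by positivity)
  · have := hN j
    exact Real.Gamma_pos_of_pos (by positivity)
  · exact Real.Gamma_pos_of_pos (by positivity)
  · exact sub_pos.2 (Nat.cast_lt.2 (Fin.rev_lt_rev.2 (mem_Ioi.1 hij)))

namespace IsAlternantQuotient

theorem average_div_average_one {m : ℕ → ℕ}
    (hf : IsAlternantQuotient (fun j : Fin N => m j + Fin.rev j) f) (ha : 0 < a) (hb : 0 < b) :
    average N a b f / average N a b (fun _ => 1) =
      weylDimension m N * ∏ i ∈ range N, ∏ t ∈ range (m i),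
        (a + N - (i + 1) + t) / (a + b + 2 * N - (i + 1) + t - 1) := by
  have hGammaB : ∏ k : Fin N, Real.Gamma (b + k) ≠ 0 :=
    (prod_pos fun k _ => Real.Gamma_pos_of_pos (by positivity)).ne'
  rw [hf.average_eq ha hb, (isAlternantQuotient_one N).average_eq ha hb, mul_div_mul_comm,
    mul_div_mul_left _ _ hGammaB, prod_sub_div_prod_sub_rev, ← prod_div_distrib, mul_comm,
    ← Fin.prod_univ_eq_prod_range (fun i => ∏ t ∈ range (m i),
      (a + N - (i + 1) + t) / (a + b + 2 * N - (i + 1) + t - 1))]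
  exact congrArg _ (prod_congr rfl fun i _ => Gamma_quotient_div_Gamma_quotient_rev ha hb (m i) i)

end IsAlternantQuotient

end Averages

section Schur

theorem rowLen_eq_zero_of_length_le {lam : YoungDiagram} {i : ℕ} (hi : length lam ≤ i) :
    lam.rowLen i = 0 := by
  by_contra hne
  have hmem : (i, 0) ∈ lam := YoungDiagram.mem_iff_lt_rowLen.2 (Nat.pos_of_ne_zero hne)
  exact (YoungDiagram.mem_iff_lt_colLen.1 hmem).not_ge hi

theorem average_schur_div_average_one {N : ℕ} {a b : ℝ} {lam : YoungDiagram}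
    (hN : length lam ≤ N) (ha : 0 < a) (hb : 0 < b) :
    average N a b (schur N lam) / average N a b (fun _ => 1) =
      ∏ i ∈ range (length lam),
        ((∏ j ∈ Ioo i (length lam),
            ((lam.rowLen i : ℝ) - lam.rowLen j + j - i) / ((j : ℝ) - i)) *
          ∏ j ∈ range (lam.rowLen i),
            (((j : ℝ) + N - (i + 1) + 1) * (a + N - (i + 1) + j)) /
              (((length lam : ℝ) + j - (i + 1) + 1) *
                (a + b + 2 * N - (i + 1) + j - 1))) := by
  have hrows : ∏ i ∈ range N, ∏ t ∈ range (lam.rowLen i),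
        (a + N - (i + 1) + t) / (a + b + 2 * N - (i + 1) + t - 1) =
      ∏ i ∈ range (length lam), ∏ t ∈ range (lam.rowLen i),
        (a + N - (i + 1) + t) / (a + b + 2 * N - (i + 1) + t - 1) :=
    (prod_subset (range_mono hN) fun i _ hi => by
      rw [rowLen_eq_zero_of_length_le (not_lt.1 (mt mem_range.2 hi)), prod_range_zero]).symm
  rw [(isAlternantQuotient_schur N lam).average_div_average_one ha hb, hrows,
    weylDimension_eq_mul_of_eq_zero hN fun i => rowLen_eq_zero_of_length_le, weylDimension,
    mul_assoc, ← prod_mul_distrib, ← prod_mul_distrib]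
  refine prod_congr rfl fun i _ => congrArg _ ?_
  rw [← prod_mul_distrib]
  refine prod_congr rfl fun t _ => ?_
  rw [div_mul_div_comm]
  congr 2 <;> ring

end Schur

section Asymptotics

open Filter Topology

theorem tendsto_mul_add_div_natCast (c d : ℝ) :
    Tendsto (fun N : ℕ => (c * N + d) / N) atTop (𝓝 c) := by
  simpa [add_comm] using tendsto_add_mul_div_add_mul_atTop_nhds d 0 c one_ne_zero

theorem nonneg_of_eventually_mul_natCast_add_pos {c d : ℝ}
    (h : ∀ᶠ N : ℕ in atTop, 0 < c * N + d) : 0 ≤ c :=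
  ge_of_tendsto (tendsto_mul_add_div_natCast c d) <| h.mono fun N hN => by positivity

theorem tendsto_content_factor_div (a₀ a₁ b₀ b₁ l : ℝ) (i j : ℕ) (h : 2 + a₁ + b₁ ≠ 0) :
    Tendsto (fun N : ℕ =>
      (((j : ℝ) + N - (i + 1) + 1) * (a₁ * N + a₀ + N - (i + 1) + j)) /
        ((l + j - (i + 1) + 1) *
          (a₁ * N + a₀ + (b₁ * N + b₀) + 2 * N - (i + 1) + j - 1)) / N)
      atTop (𝓝 ((1 + a₁) / (2 + a₁ + b₁) * (1 / (l + j - (i + 1) + 1)))) := by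
  have hfirst := tendsto_mul_add_div_natCast 1 ((j : ℝ) - i)
  have hsecond := tendsto_add_mul_div_add_mul_atTop_nhds (a₀ - (i + 1) + j)
    (a₀ + b₀ - (i + 1) + j - 1) (1 + a₁) h
  have hlim := (hfirst.mul hsecond).mul_const (1 / (l + j - (i + 1) + 1))
  rw [one_mul] at hlim
  refine hlim.congr fun N => ?_
  rw [div_mul_div_comm, div_mul_div_comm, div_div]
  congr 1 <;> ring

theorem pow_size (c : ℝ) (lam : YoungDiagram) :
    c ^ size lam = ∏ i ∈ range (length lam), ∏ _j ∈ range (lam.rowLen i), c := by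
  simp only [size, prod_const, card_range, prod_pow_eq_pow_sum]

theorem tendsto_average_schur_div (lam : YoungDiagram) {a₀ a₁ b₀ b₁ : ℝ}
    (hpos : ∀ᶠ N : ℕ in atTop, 0 < a₁ * N + a₀ ∧ 0 < b₁ * N + b₀) :
    Tendsto
      (fun N : ℕ =>
        average N (a₁ * N + a₀) (b₁ * N + b₀) (schur N lam) /
          ((N : ℝ) ^ size lam * average N (a₁ * N + a₀) (b₁ * N + b₀) (fun _ => 1)))
      atTop
      (𝓝 (((1 + a₁) / (2 + a₁ + b₁)) ^ size lam *
        ∏ i ∈ range (length lam),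
          ((∏ j ∈ Ioo i (length lam),
              ((lam.rowLen i : ℝ) - lam.rowLen j + j - i) / ((j : ℝ) - i)) *
            ∏ j ∈ range (lam.rowLen i), 1 / ((length lam : ℝ) + j - (i + 1) + 1)))) := by
  have ha₁ : 0 ≤ a₁ := nonneg_of_eventually_mul_natCast_add_pos (hpos.mono fun _ h => h.1)
  have hb₁ : 0 ≤ b₁ := nonneg_of_eventually_mul_natCast_add_pos (hpos.mono fun _ h => h.2)
  have hden : 2 + a₁ + b₁ ≠ 0 := by positivity
  have hlim := tendsto_finsetProd (range (length lam)) fun i _ =>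
    (tendsto_finsetProd (range (lam.rowLen i)) fun j _ =>
      tendsto_content_factor_div a₀ a₁ b₀ b₁ (length lam) i j hden).const_mul
        (∏ j ∈ Ioo i (length lam), ((lam.rowLen i : ℝ) - lam.rowLen j + j - i) / ((j : ℝ) - i))
  rw [pow_size, ← prod_mul_distrib]
  simp_rw [mul_left_comm (∏ _ ∈ range _, _ : ℝ), ← prod_mul_distrib]
  refine hlim.congr' ?_
  filter_upwards [hpos, eventually_ge_atTop (length lam)] with N hN hl
  rw [mul_comm ((N : ℝ) ^ _), ← div_div, average_schur_div_average_one hl hN.1 hN.2, pow_size,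
    ← prod_div_distrib]
  refine prod_congr rfl fun i _ => ?_
  rw [mul_div_assoc, ← prod_div_distrib]

end Asymptotics

end Selberg

/-- The indices `i`, `j` of rows start at `0`, so that `i + 1`, `j + 1` are the usual indices of
parts; the index of the inner products over `Finset.range (lam.rowLen i)` is unshifted. -/
theorem mainTheorem3 (lam : YoungDiagram) :
    (∀ (N : ℕ) (a b : ℝ), Selberg.length lam ≤ N → 0 < a → 0 < b →
      MeasureTheory.IntegrableOn (Selberg.integrand N a b (Selberg.schur N lam))
        (Set.Icc (0 : Fin N → ℝ) 1) ∧
      MeasureTheory.IntegrableOn (Selberg.integrand N a b (fun _ => 1))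
        (Set.Icc (0 : Fin N → ℝ) 1) ∧
      0 < Selberg.average N a b (fun _ => 1) ∧
      Selberg.average N a b (Selberg.schur N lam) / Selberg.average N a b (fun _ => 1) =
        ∏ i ∈ Finset.range (Selberg.length lam),
          ((∏ j ∈ Finset.Ioo i (Selberg.length lam),
              ((lam.rowLen i : ℝ) - lam.rowLen j + j - i) / ((j : ℝ) - i)) *
            ∏ j ∈ Finset.range (lam.rowLen i),
              (((j : ℝ) + N - (i + 1) + 1) * (a + N - (i + 1) + j)) /
                (((Selberg.length lam : ℝ) + j - (i + 1) + 1) *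
                  (a + b + 2 * N - (i + 1) + j - 1)))) ∧
    (∀ a₀ a₁ b₀ b₁ : ℝ,
      (∀ᶠ N : ℕ in Filter.atTop, 0 < a₁ * N + a₀ ∧ 0 < b₁ * N + b₀) →
      Filter.Tendsto
        (fun N : ℕ =>
          Selberg.average N (a₁ * N + a₀) (b₁ * N + b₀) (Selberg.schur N lam) /
            ((N : ℝ) ^ Selberg.size lam *
              Selberg.average N (a₁ * N + a₀) (b₁ * N + b₀) (fun _ => 1)))
        Filter.atTop
        (nhds (((1 + a₁) / (2 + a₁ + b₁)) ^ Selberg.size lam *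
          ∏ i ∈ Finset.range (Selberg.length lam),
            ((∏ j ∈ Finset.Ioo i (Selberg.length lam),
                ((lam.rowLen i : ℝ) - lam.rowLen j + j - i) / ((j : ℝ) - i)) *
              ∏ j ∈ Finset.range (lam.rowLen i),
                1 / ((Selberg.length lam : ℝ) + j - (i + 1) + 1))))) :=
  ⟨fun N _ _ hN ha hb =>
    ⟨(Selberg.isAlternantQuotient_schur N lam).integrableOn_integrand ha hb,
      (Selberg.isAlternantQuotient_one N).integrableOn_integrand ha hb,
      Selberg.average_one_pos ha hb, Selberg.average_schur_div_average_one hN ha hb⟩,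
    fun _ _ _ _ hpos => Selberg.tendsto_average_schur_div lam hpos⟩
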